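/- Let $\mathcal H$ be a finite-dimensional Hilbert space and, for each $n\in\mathbb N$, let $\rho^{(n)},\sigma^{(n)}$ be density operators on $\mathcal H^{\otimes n}$. Logarithms are to base two, with $\log 0=-\infty$, suprema, infima and upper limits are taken in $[-\infty,+\infty]$, and powers of positive semidefinite operators use $0^x=0$. For $\alpha\in(0,1)$ let $$D_{\mathrm{Petz},\alpha}(\rho\|\sigma)=\frac{1}{\alpha-1}\log\operatorname{tr}\big[\rho^{\alpha}\sigma^{1-\alpha}\big],\qquad D^{\infty}_{\mathrm{Petz},\alpha}=\lim_{n\to\infty}\frac1n D_{\mathrm{Petz},\alpha}\big(\rho^{(n)}\|\sigma^{(n)}\big),$$ and for $r>0$ let $$\alpha_{n,r}(\rho^{(n)}\|\sigma^{(n)})=\min_{0\le M\le I}\Big\{\operatorname{tr}\big[\rho^{(n)}(I-M)\big] : \operatorname{tr}\big[\sigma^{(n)}M\big]\le 2^{-nr}\Big\}.$$ Assume that for every $s\in(0,1)$ the limit $$\phi(s)=\lim_{n\to\infty}\frac1n\log\operatorname{tr}\big[(\rho^{(n)})^{1-s}(\sigma^{(n)})^{s}\big]$$ exists and is finite, and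 that $\phi$ is strictly convex and $C^1$ on $(0,1)$. Then the limit defining $D^{\infty}_{\mathrm{Petz},\alpha}$ exists for every $\alpha\in(0,1)$, and for every real $r$ with $$0<r<\sup_{\alpha\in(0,1)}D^{\infty}_{\mathrm{Petz},\alpha},\qquad r\neq\inf_{\alpha\in(0,1)}D^{\infty}_{\mathrm{Petz},\alpha},$$ one has $$\limsup_{n\to\infty}-\frac1n\log\alpha_{n,r}\big(\rho^{(n)}\|\sigma^{(n)}\big)\le\sup_{\alpha\in(0,1)}\frac{\alpha-1}{\alpha}\Big(r-D^{\infty}_{\mathrm{Petz},\alpha}\Big).$$ (The condition $r\ne\inf_\alpha D^\infty_{\mathrm{Petz},\alpha}$ is automatic when $\lim_{s\to1^-}\phi(s)=0$, since the infimum is then $0$.) -/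

import Mathlib

open Set Filter Topology
open scoped ComplexOrder

namespace QHoeffding

/-- Density operators, written as matrices in an orthonormal basis indexed by `κ`. -/
def IsState {κ : Type*} [Fintype κ] (ρ : Matrix κ κ ℂ) : Prop :=
  ρ.PosSemidef ∧ ρ.trace = 1

/-- Operators on `H^{⊗ n}` for `H = ℂ^ι`, as matrices in the product basis, whose elements
are labelled by the words `Fin n → ι`. -/
abbrev TensorPowerOp (ι : Type*) (n : ℕ) : Type _ :=
  Matrix (Fin n → ι) (Fin n → ι) ℂ

/-- The base-two logarithm on `[0, ∞)` with values in the extended reals, `log 0 = -∞`. -/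
noncomputable def log2 (x : ℝ) : EReal :=
  if x ≤ 0 then ⊥ else ((Real.logb 2 x : ℝ) : EReal)

/-- The power `A ^ s` of a positive semidefinite matrix for `s > 0`, by the functional calculus
(with `0 ^ s = 0`). -/
noncomputable def matPow {κ : Type*} [Fintype κ] [DecidableEq κ]
    (A : Matrix κ κ ℂ) (s : ℝ) : Matrix κ κ ℂ :=
  cfc (fun x : ℝ => x ^ s) A

/-- The Petz quasi-divergence `tr (ρ ^ α σ ^ (1 - α))` for `α ∈ (0,1)`. -/
noncomputable def petzQ {κ : Type*} [Fintype κ] [DecidableEq κ]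
    (α : ℝ) (ρ σ : Matrix κ κ ℂ) : ℝ :=
  (matPow ρ α * matPow σ (1 - α)).trace.re

/-- The Petz Rényi divergence for `α ∈ (0,1)`; it is `+∞` when `petzQ α ρ σ = 0`. -/
noncomputable def petzD {κ : Type*} [Fintype κ] [DecidableEq κ]
    (α : ℝ) (ρ σ : Matrix κ κ ℂ) : EReal :=
  ((1 / (α - 1) : ℝ) : EReal) * log2 (petzQ α ρ σ)

/-- The `n`-th term `(1/n) D_α(ρ^{(n)} ‖ σ^{(n)})` of the regularization. -/
noncomputable def petzRate {ι : Type*} [Fintype ι] [DecidableEq ι]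
    (α : ℝ) (ρ σ : ∀ n : ℕ, TensorPowerOp ι n) (n : ℕ) : EReal :=
  ((1 / (n : ℝ) : ℝ) : EReal) * petzD α (ρ n) (σ n)

/-- The regularized Petz Rényi divergence. It is written as an upper limit, so that it is always
defined; it is the limit whenever the limit exists. -/
noncomputable def petzReg {ι : Type*} [Fintype ι] [DecidableEq ι]
    (α : ℝ) (ρ σ : ∀ n : ℕ, TensorPowerOp ι n) : EReal :=
  limsup (petzRate α ρ σ) atTop

/-- Tests (effects): `0 ≤ M ≤ I`. -/
def IsTest {κ : Type*} [Fintype κ] [DecidableEq κ] (M : Matrix κ κ ℂ) : Prop :=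
  M.PosSemidef ∧ (1 - M).PosSemidef

/-- The optimal Type-I error `α_{n,r}(ρ ‖ σ)`: the least value of `tr (ρ (I - M))` over all tests
`M` with `tr (σ M) ≤ 2 ^ (-n r)`. -/
noncomputable def optTypeI {κ : Type*} [Fintype κ] [DecidableEq κ]
    (n : ℕ) (r : ℝ) (ρ σ : Matrix κ κ ℂ) : ℝ :=
  sInf {a : ℝ | ∃ M : Matrix κ κ ℂ, IsTest M ∧
    (σ * M).trace.re ≤ (2 : ℝ) ^ (-((n : ℝ) * r)) ∧ a = (ρ * (1 - M)).trace.re}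

end QHoeffding

/-! The Nussbaum–Szkoła weights turn the converse into a classical change of measure. Tilting to
parameter `s` concentrates the likelihood ratio of `σ` to `ρ` near `2 ^ (n φ'(s))`, as
differentiability of `φ` at `s` makes the neighbouring tilts `s ± δ` control both tails. Hence every
admissible test has Type-I error at least `2 ^ (n (φ s - s φ'(s) - ε))` for large `n`, provided `g s
:= -φ s - (1 - s) φ'(s) < r` (`eventually_le_optTypeI`), and the exponent is at most `s φ'(s) - φ s`
(`limsup_optTypeI_le`).

With `α = 1 - s` one has `D_α = -φ s / s`, and the objective on the right becomes `(-(s r) - φ s) /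
(1 - s)`. The two expressions agree where `g s = r`. Convexity makes `g` decreasing, so what remains
is `r` above all values of `g` (let `s → 0`) or below all of them. In the latter case the supremum
is `+∞` unless `r = inf D_α`. -/

namespace QHoeffding

/-! ### Reduction of a pair of matrices to classical weights. -/

section Matrix

variable {κ : Type*} [Fintype κ] [DecidableEq κ]

open Matrix

/-- The trace of a product of two diagonal matrices, one of them conjugated. -/
theorem trace_diagonal_mul_conj (A : Matrix κ κ ℂ) (f g : κ → ℝ) :
    (diagonal (fun i => (f i : ℂ)) * (A * diagonal (fun i => (g i : ℂ)) * Aᴴ)).trace.re =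
      ∑ i, ∑ j, f i * g j * Complex.normSq (A i j) := by
  simp only [Matrix.trace, Matrix.diag_apply, Matrix.diagonal_mul, Complex.re_sum]
  refine Finset.sum_congr rfl fun i _ => ?_
  rw [Matrix.mul_apply, Finset.mul_sum, Complex.re_sum]
  refine Finset.sum_congr rfl fun j _ => ?_
  rw [Matrix.mul_diagonal, Matrix.conjTranspose_apply, mul_assoc (f i),
    Complex.re_ofReal_mul, mul_right_comm, RCLike.star_def, Complex.mul_conj, ← Complex.ofReal_mul,
    Complex.ofReal_re, mul_comm (g j)]

theorem IsTest.compl {M : Matrix κ κ ℂ} (hM : IsTest M) : IsTest (1 - M) :=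
  ⟨hM.2, by simpa using hM.1⟩

/-- `M - M² = M (1 - M) M + (1 - M) M (1 - M)`. -/
theorem IsTest.sub_sq_posSemidef {M : Matrix κ κ ℂ} (hM : IsTest M) :
    (M - M * M).PosSemidef := by
  have h1 := hM.2.conjTranspose_mul_mul_same M
  have h2 := hM.1.conjTranspose_mul_mul_same (1 - M)
  rw [hM.1.1.eq] at h1
  rw [hM.2.1.eq] at h2
  convert h1.add h2 using 1
  noncomm_ring

/-- Replacing a test by its square does not increase expectation values. -/
theorem IsTest.trace_mul_sq_le {M : Matrix κ κ ℂ} (hM : IsTest M) {d : κ → ℝ}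
    (hd : ∀ i, 0 ≤ d i) (U : Matrix κ κ ℂ) :
    (U * diagonal (fun i => (d i : ℂ)) * Uᴴ * (M * M)).trace.re ≤
      (U * diagonal (fun i => (d i : ℂ)) * Uᴴ * M).trace.re := by
  have h := hM.sub_sq_posSemidef.conjTranspose_mul_mul_same U
  have key : (U * diagonal (fun i => (d i : ℂ)) * Uᴴ * (M - M * M)).trace =
      (diagonal (fun i => (d i : ℂ)) * (Uᴴ * (M - M * M) * U)).trace := by
    rw [Matrix.mul_assoc, Matrix.mul_assoc, Matrix.trace_mul_comm]
    simp only [Matrix.mul_assoc]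
  have : 0 ≤ (U * diagonal (fun i => (d i : ℂ)) * Uᴴ * (M - M * M)).trace.re := by
    rw [key]
    simp only [Matrix.trace, Matrix.diag_apply, Matrix.diagonal_mul, Complex.re_sum]
    refine Finset.sum_nonneg fun i _ => ?_
    rw [Complex.re_ofReal_mul]
    exact mul_nonneg (hd i) (Complex.le_def.1 h.diag_nonneg).1
  rw [mul_sub, Matrix.trace_sub, Complex.sub_re] at this
  linarith

theorem normSq_add_le (x y : ℂ) :
    Complex.normSq (x + y) ≤ 2 * (Complex.normSq x + Complex.normSq y) := by
  simp only [Complex.normSq_apply, Complex.add_re, Complex.add_im]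
  nlinarith [sq_nonneg (x.re - y.re), sq_nonneg (x.im - y.im)]

/-- The Nussbaum–Szkoła reduction of a pair of positive semidefinite matrices to a pair of
nonnegative weights `a i * w i j`, `b j * w i j`. -/
theorem exists_nussbaumSzkola {ρ σ : Matrix κ κ ℂ} (hρ : ρ.PosSemidef) (hσ : σ.PosSemidef) :
    ∃ (a b : κ → ℝ) (w : κ → κ → ℝ), (∀ i, 0 ≤ a i) ∧ (∀ j, 0 ≤ b j) ∧ (∀ i j, 0 ≤ w i j) ∧
      (∀ f g : ℝ → ℝ, (cfc f ρ * cfc g σ).trace.re = ∑ i, ∑ j, f (a i) * g (b j) * w i j) ∧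
      ∀ M, IsTest M → ∀ c : ℝ, 0 ≤ c →
        (∑ i, ∑ j, min (a i) (c * b j) * w i j) / 2 ≤
          (ρ * (1 - M)).trace.re + c * (σ * M).trace.re := by
  have hcfc : ∀ {A : Matrix κ κ ℂ} (hA : A.IsHermitian) (f : ℝ → ℝ), cfc f A =
      (hA.eigenvectorUnitary : Matrix κ κ ℂ) * diagonal (fun i => (f (hA.eigenvalues i) : ℂ)) *
        (hA.eigenvectorUnitary : Matrix κ κ ℂ)ᴴ := by
    intro A hA f
    rw [hA.cfc_eq, Matrix.IsHermitian.cfc, Unitary.conjStarAlgAut_apply]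
    rfl
  have hid : ∀ {A : Matrix κ κ ℂ} (hA : A.IsHermitian), A =
      (hA.eigenvectorUnitary : Matrix κ κ ℂ) * diagonal (fun i => (hA.eigenvalues i : ℂ)) *
        (hA.eigenvectorUnitary : Matrix κ κ ℂ)ᴴ := by
    intro A hA
    conv_lhs => rw [hA.spectral_theorem, Unitary.conjStarAlgAut_apply]
    rfl
  have hU : ∀ {A : Matrix κ κ ℂ} (hA : A.IsHermitian),
      (hA.eigenvectorUnitary : Matrix κ κ ℂ)ᴴ * (hA.eigenvectorUnitary : Matrix κ κ ℂ) = 1 ∧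
      (hA.eigenvectorUnitary : Matrix κ κ ℂ) * (hA.eigenvectorUnitary : Matrix κ κ ℂ)ᴴ = 1 :=
    fun hA => ⟨Unitary.coe_star_mul_self _, Unitary.coe_mul_star_self _⟩
  have ha := hρ.eigenvalues_nonneg
  have hb := hσ.eigenvalues_nonneg
  have hρf := hcfc hρ.1
  have hσf := hcfc hσ.1
  have hρe := hid hρ.1
  have hσe := hid hσ.1
  have hUU := hU hρ.1
  have hVV := hU hσ.1
  generalize hρ.1.eigenvalues = a at *
  generalize hσ.1.eigenvalues = b at *
  generalize (hρ.1.eigenvectorUnitary : Matrix κ κ ℂ) = U at *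
  generalize (hσ.1.eigenvectorUnitary : Matrix κ κ ℂ) = V at *
  have htr : ∀ (N : Matrix κ κ ℂ) (f g : κ → ℝ), N.IsHermitian →
      ((U * diagonal (fun i => (f i : ℂ)) * Uᴴ) * (N * (V * diagonal (fun i => (g i : ℂ)) * Vᴴ)
        * N)).trace.re = ∑ i, ∑ j, f i * g j * Complex.normSq ((Uᴴ * N * V) i j) := by
    intro N f g hN
    rw [← trace_diagonal_mul_conj]
    congr 1
    simp only [Matrix.conjTranspose_mul, Matrix.conjTranspose_conjTranspose, hN.eq]
    rw [Matrix.mul_assoc, Matrix.mul_assoc, Matrix.trace_mul_comm]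
    simp only [Matrix.mul_assoc]
  refine ⟨a, b, fun i j => Complex.normSq ((Uᴴ * V) i j), ha, hb,
    fun i j => Complex.normSq_nonneg _, fun f g => ?_, fun M hM c hc => ?_⟩
  · have := htr 1 (fun i => f (a i)) (fun j => g (b j)) Matrix.isHermitian_one
    simpa only [hρf, hσf, Matrix.mul_one, Matrix.one_mul] using this
  -- Squaring the effects gives sums of `|⟨u_i, (1 - M) v_j⟩|²` and `|⟨u_i, M v_j⟩|²`. The two
  -- amplitudes add up to `⟨u_i, v_j⟩`, and `normSq_add_le` costs the factor 2.
  · have h1 := hM.compl.trace_mul_sq_le ha U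
    have h2 := hM.trace_mul_sq_le hb V
    have e1 := htr (1 - M) a (fun _ => 1) hM.2.1
    have e2 := htr M (fun _ => 1) b hM.1.1
    simp only [Complex.ofReal_one, Matrix.diagonal_one, Matrix.mul_one, Matrix.one_mul, hUU.2,
      hVV.2] at e1 e2
    rw [Matrix.mul_assoc, Matrix.trace_mul_comm, Matrix.mul_assoc] at e2
    rw [← hρe] at h1 e1
    rw [← hσe] at h2 e2
    rw [e1] at h1
    rw [e2] at h2
    have hsum : (∑ i, ∑ j, min (a i) (c * b j) * Complex.normSq ((Uᴴ * V) i j)) / 2 ≤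
        ∑ i, ∑ j, a i * 1 * Complex.normSq ((Uᴴ * (1 - M) * V) i j) +
          c * ∑ i, ∑ j, 1 * b j * Complex.normSq ((Uᴴ * M * V) i j) := by
      rw [Finset.mul_sum, ← Finset.sum_add_distrib, Finset.sum_div]
      refine Finset.sum_le_sum fun i _ => ?_
      rw [Finset.mul_sum, ← Finset.sum_add_distrib, Finset.sum_div]
      refine Finset.sum_le_sum fun j _ => ?_
      have hW : (Uᴴ * V) i j = (Uᴴ * (1 - M) * V) i j + (Uᴴ * M * V) i j := by
        rw [← Matrix.add_apply]
        rw [Matrix.mul_sub, Matrix.mul_one, Matrix.sub_mul, sub_add_cancel]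
      rw [hW]
      have hn := normSq_add_le ((Uᴴ * (1 - M) * V) i j) ((Uᴴ * M * V) i j)
      have hx := Complex.normSq_nonneg ((Uᴴ * (1 - M) * V) i j)
      have hy := Complex.normSq_nonneg ((Uᴴ * M * V) i j)
      have hm : 0 ≤ min (a i) (c * b j) := le_min (ha i) (mul_nonneg hc (hb j))
      have := mul_le_mul_of_nonneg_left hn hm
      have := mul_le_mul_of_nonneg_right (min_le_left (a i) (c * b j)) hx
      have := mul_le_mul_of_nonneg_right (min_le_right (a i) (c * b j)) hy
      linarith
    linarith [mul_le_mul_of_nonneg_left h2 hc]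

end Matrix

/-! ### Scalar inequalities. -/

/-- A pointwise lower bound for `min p (q / L)` by tilted weights `p ^ (1 - s) * q ^ s`. -/
theorem tilted_le_min {p q L e s δ : ℝ} (hp : 0 ≤ p) (hq : 0 ≤ q) (hL : 0 < L) (he : 1 ≤ e)
    (hδ : 0 < δ) (h0 : 0 < s - δ) (h1 : s + δ < 1) :
    L ^ (-s) * e⁻¹ * (p ^ (1 - s) * q ^ s - (L * e) ^ (-δ) * (p ^ (1 - (s + δ)) * q ^ (s + δ)) -
      (L / e) ^ δ * (p ^ (1 - (s - δ)) * q ^ (s - δ))) ≤ min p (L⁻¹ * q) := by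
  have he0 : 0 < e := by linarith
  rcases hp.eq_or_lt with rfl | hp
  · rw [Real.zero_rpow (by linarith), Real.zero_rpow (by linarith), Real.zero_rpow (by linarith)]
    simp only [zero_mul, mul_zero, sub_zero]
    positivity
  rcases hq.eq_or_lt with rfl | hq
  · rw [Real.zero_rpow (by linarith), Real.zero_rpow (by linarith), Real.zero_rpow (by linarith)]
    simp only [mul_zero, sub_zero]
    positivity
  obtain ⟨x, hx, rfl⟩ : ∃ x : ℝ, 0 < x ∧ q = p * L * x :=
    ⟨q / (p * L), by positivity, by field_simp⟩
  have hsplit : ∀ t : ℝ, p ^ (1 - t) * (p * L * x) ^ t = p * L ^ t * x ^ t := by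
    intro t
    rw [Real.mul_rpow (by positivity) hx.le, Real.mul_rpow hp.le hL.le, Real.rpow_sub hp,
      Real.rpow_one]
    have := (Real.rpow_pos_of_pos hp t).ne'
    field_simp
  have hLs := Real.rpow_pos_of_pos hL s
  have hLd := Real.rpow_pos_of_pos hL δ
  have hed := Real.rpow_pos_of_pos he0 δ
  have hxs := Real.rpow_pos_of_pos hx s
  have hxd := Real.rpow_pos_of_pos hx δ
  have e1 : L ^ (-s) * e⁻¹ * (p ^ (1 - s) * (p * L * x) ^ s -
      (L * e) ^ (-δ) * (p ^ (1 - (s + δ)) * (p * L * x) ^ (s + δ)) -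
      (L / e) ^ δ * (p ^ (1 - (s - δ)) * (p * L * x) ^ (s - δ))) =
      p * (e⁻¹ * x ^ s * (1 - x ^ δ / e ^ δ - 1 / (e ^ δ * x ^ δ))) := by
    rw [hsplit, hsplit, hsplit, Real.rpow_neg hL.le, Real.rpow_neg (by positivity),
      Real.mul_rpow hL.le he0.le, Real.div_rpow hL.le he0.le, Real.rpow_add hL, Real.rpow_add hx,
      Real.rpow_sub hL, Real.rpow_sub hx]
    field_simp
  have e2 : min p (L⁻¹ * (p * L * x)) = p * min 1 x := by
    rw [mul_min_of_nonneg _ _ hp.le, mul_one]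
    congr 1
    field_simp
  rw [e1, e2]
  refine mul_le_mul_of_nonneg_left ?_ hp.le
  have hm : 0 ≤ min 1 x := le_min zero_le_one hx.le
  have hpre : 0 ≤ e⁻¹ * x ^ s := by positivity
  have t1 : 0 ≤ x ^ δ / e ^ δ := by positivity
  have t2 : 0 ≤ 1 / (e ^ δ * x ^ δ) := by positivity
  -- For `x > e` or `x < 1 / e` one subtracted term is at least 1 and the left side is nonpositive;
  -- in between, `e⁻¹ x ^ s ≤ min 1 x`.
  rcases lt_or_ge e x with hex | hex
  · refine le_trans (mul_nonpos_of_nonneg_of_nonpos hpre ?_) hm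
    have : 1 ≤ x ^ δ / e ^ δ := (one_le_div hed).2 (Real.rpow_le_rpow he0.le hex.le hδ.le)
    linarith
  rcases lt_or_ge (e * x) 1 with hex' | hex'
  · refine le_trans (mul_nonpos_of_nonneg_of_nonpos hpre ?_) hm
    have : 1 ≤ 1 / (e ^ δ * x ^ δ) := by
      rw [one_le_div (by positivity), ← Real.mul_rpow he0.le hx.le]
      exact Real.rpow_le_one (by positivity) hex'.le hδ.le
    linarith
  refine le_trans (mul_le_of_le_one_right hpre (by linarith)) (le_min ?_ ?_)
  · rw [inv_mul_le_iff₀ he0, mul_one]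
    calc x ^ s ≤ e ^ s := Real.rpow_le_rpow hx.le hex (by linarith)
      _ ≤ e ^ (1 : ℝ) := Real.rpow_le_rpow_of_exponent_le he (by linarith)
      _ = e := Real.rpow_one e
  · rw [inv_mul_le_iff₀ he0]
    calc x ^ s = x ^ s * 1 := (mul_one _).symm
      _ ≤ x ^ s * (e * x) ^ (1 - s) := by
        gcongr
        exact Real.one_le_rpow hex' (by linarith)
      _ = e ^ (1 - s) * x := by
        rw [Real.mul_rpow he0.le hx.le, Real.rpow_sub hx, Real.rpow_one]
        field_simp
      _ ≤ e ^ (1 : ℝ) * x := by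
        gcongr
        linarith
      _ = e * x := by rw [Real.rpow_one]

theorem rpow_mul_rpow_le_add {a b s : ℝ} (ha : 0 ≤ a) (hb : 0 ≤ b) (h0 : 0 < s) (h1 : s < 1) :
    a ^ (1 - s) * b ^ s ≤ (1 - s) * a + s * b :=
  Real.geom_mean_le_arith_mean2_weighted (by linarith) h0.le ha hb (by ring)

/-! ### Error bounds for a single pair of states. -/

section States

variable {κ : Type*} [Fintype κ] [DecidableEq κ] {ρ σ : Matrix κ κ ℂ}

/-- A quantum Neyman–Pearson type bound in terms of the quantities `tr (ρ ^ (1 - t) σ ^ t)`. -/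
theorem tilted_trace_le_errors (hρ : ρ.PosSemidef) (hσ : σ.PosSemidef) {L e s δ : ℝ} (hL : 0 < L)
    (he : 1 ≤ e) (hδ : 0 < δ) (h0 : 0 < s - δ) (h1 : s + δ < 1) {M : Matrix κ κ ℂ}
    (hM : IsTest M) :
    L ^ (-s) * e⁻¹ * ((matPow ρ (1 - s) * matPow σ s).trace.re -
      (L * e) ^ (-δ) * (matPow ρ (1 - (s + δ)) * matPow σ (s + δ)).trace.re -
      (L / e) ^ δ * (matPow ρ (1 - (s - δ)) * matPow σ (s - δ)).trace.re) / 2 ≤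
      (ρ * (1 - M)).trace.re + L⁻¹ * (σ * M).trace.re := by
  obtain ⟨a, b, w, ha, hb, hw, htr, hmin⟩ := exists_nussbaumSzkola hρ hσ
  refine le_trans (div_le_div_of_nonneg_right ?_ zero_le_two) (hmin M hM L⁻¹ (by positivity))
  simp only [matPow, htr, Finset.mul_sum, ← Finset.sum_sub_distrib]
  refine Finset.sum_le_sum fun i _ => Finset.sum_le_sum fun j _ => ?_
  have := mul_le_mul_of_nonneg_right (tilted_le_min (ha i) (hb j) hL he hδ h0 h1) (hw i j)
  refine le_trans (le_of_eq ?_) this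
  ring

/-- Weighted AM–GM on the weights; `a i * w i j` and `b j * w i j` each have total mass 1. -/
theorem trace_matPow_mul_matPow_le_one (hρ : IsState ρ) (hσ : IsState σ) {s : ℝ} (h0 : 0 < s)
    (h1 : s < 1) : (matPow ρ (1 - s) * matPow σ s).trace.re ≤ 1 := by
  obtain ⟨a, b, w, ha, hb, hw, htr, -⟩ := exists_nussbaumSzkola hρ.1 hσ.1
  have ea := htr id (fun _ => 1)
  have eb := htr (fun _ => 1) id
  rw [cfc_id ℝ ρ hρ.1.1.isSelfAdjoint, cfc_const_one ℝ σ hσ.1.1.isSelfAdjoint, mul_one, hρ.2,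
    Complex.one_re] at ea
  rw [cfc_id ℝ σ hσ.1.1.isSelfAdjoint, cfc_const_one ℝ ρ hρ.1.1.isSelfAdjoint, one_mul, hσ.2,
    Complex.one_re] at eb
  calc (matPow ρ (1 - s) * matPow σ s).trace.re
      = ∑ i, ∑ j, a i ^ (1 - s) * b j ^ s * w i j := htr _ _
    _ ≤ ∑ i, ∑ j, ((1 - s) * (id (a i) * 1 * w i j) + s * (1 * id (b j) * w i j)) := by
        refine Finset.sum_le_sum fun i _ => Finset.sum_le_sum fun j _ => ?_
        have := mul_le_mul_of_nonneg_right (rpow_mul_rpow_le_add (ha i) (hb j) h0 h1) (hw i j)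
        simp only [id]
        linarith
    _ = (1 - s) * ∑ i, ∑ j, id (a i) * 1 * w i j + s * ∑ i, ∑ j, 1 * id (b j) * w i j := by
        simp only [Finset.sum_add_distrib, Finset.mul_sum]
    _ = 1 := by
        rw [← ea, ← eb]
        ring

theorem le_optTypeI {n : ℕ} {r x : ℝ}
    (h : ∀ M : Matrix κ κ ℂ, IsTest M → (σ * M).trace.re ≤ (2 : ℝ) ^ (-((n : ℝ) * r)) →
      x ≤ (ρ * (1 - M)).trace.re) : x ≤ optTypeI n r ρ σ := by
  -- The test `M = 0` is feasible, which matters because `sInf ∅ = 0`.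
  refine le_csInf ⟨_, 0, ⟨Matrix.PosSemidef.zero, ?_⟩, ?_, rfl⟩ ?_
  · simpa using Matrix.PosSemidef.one
  · simp only [mul_zero, Matrix.trace_zero, Complex.zero_re]
    positivity
  · rintro _ ⟨M, hM, hM', rfl⟩
    exact h M hM hM'

end States

/-! ### Exponential rates and the asymptotic converse. -/

theorem log2_of_pos {x : ℝ} (hx : 0 < x) : log2 x = ((Real.logb 2 x : ℝ) : EReal) :=
  if_neg hx.not_ge

/-- Exponential bounds for a sequence with a given exponential rate. -/
theorem eventually_rpow_le_of_tendsto_log2 {z : ℕ → ℝ} {c η : ℝ} (hη : 0 < η)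
    (h : Tendsto (fun n : ℕ => ((1 / (n : ℝ) : ℝ) : EReal) * log2 (z n)) atTop
      (𝓝 ((c : ℝ) : EReal))) :
    ∀ᶠ n : ℕ in atTop, (2 : ℝ) ^ (n * (c - η)) ≤ z n ∧ z n ≤ (2 : ℝ) ^ (n * (c + η)) := by
  have hl : ((c - η : ℝ) : EReal) < (c : EReal) := EReal.coe_lt_coe_iff.2 (by linarith)
  have hu : (c : EReal) < ((c + η : ℝ) : EReal) := EReal.coe_lt_coe_iff.2 (by linarith)
  filter_upwards [h.eventually_const_lt hl, h.eventually_lt_const hu, eventually_gt_atTop 0]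
    with n h1 h2 hn
  have hn' : (0 : ℝ) < n := by exact_mod_cast hn
  rcases le_or_gt (z n) 0 with hz | hz
  · rw [log2, if_pos hz, EReal.coe_mul_bot_of_pos (by positivity)] at h1
    exact absurd h1 not_lt_bot
  · rw [log2_of_pos hz, ← EReal.coe_mul, EReal.coe_lt_coe_iff, one_div,
      ← div_eq_inv_mul] at h1 h2
    rw [lt_div_iff₀' hn'] at h1
    rw [div_lt_iff₀' hn'] at h2
    exact ⟨(Real.le_logb_iff_rpow_le one_lt_two hz).1 h1.le,
      (Real.logb_le_iff_le_rpow one_lt_two hz).1 h2.le⟩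

theorem eventually_two_rpow_neg_mul_le {c K : ℝ} (hc : 0 < c) (hK : 0 < K) :
    ∀ᶠ n : ℕ in atTop, (2 : ℝ) ^ (-(n * c)) ≤ K := by
  have h1 : Tendsto (fun n : ℕ => (n : ℝ) * c) atTop atTop :=
    tendsto_natCast_atTop_atTop.atTop_mul_const hc
  filter_upwards [h1.eventually_ge_atTop (-Real.logb 2 K)] with n hn
  rw [← Real.le_logb_iff_rpow_le one_lt_two hK]
  linarith

section Converse

variable {ι : Type*} [Fintype ι] [DecidableEq ι] {ρ σ : ∀ n : ℕ, TensorPowerOp ι n}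

theorem eventually_le_optTypeI (hρ : ∀ n, IsState (ρ n)) (hσ : ∀ n, IsState (σ n)) {φ : ℝ → ℝ}
    (hφ : ∀ s ∈ Ioo (0 : ℝ) 1, Tendsto (fun n : ℕ => ((1 / (n : ℝ) : ℝ) : EReal) *
      log2 (matPow (ρ n) (1 - s) * matPow (σ n) s).trace.re) atTop (𝓝 ((φ s : ℝ) : EReal)))
    {s d r ε : ℝ} (hs : s ∈ Ioo (0 : ℝ) 1) (hd : HasDerivAt φ d s)
    (hr : -φ s - (1 - s) * d < r) (hε : 0 < ε) :
    ∀ᶠ n : ℕ in atTop, (2 : ℝ) ^ (n * (φ s - s * d - ε)) ≤ optTypeI n r (ρ n) (σ n) := by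
  -- `κ` is the exponential slack: `2 κ` is lost in the tilted bound, and a third `κ` makes the
  -- Type-II term negligible.
  obtain ⟨κ, hκ, hκ1, hκ2⟩ : ∃ κ : ℝ, 0 < κ ∧ 3 * κ ≤ ε ∧ 3 * κ ≤ r + φ s + (1 - s) * d := by
    refine ⟨min (ε / 3) ((r + φ s + (1 - s) * d) / 3), lt_min (by linarith) (by linarith), ?_, ?_⟩
    · linarith [min_le_left (ε / 3) ((r + φ s + (1 - s) * d) / 3)]
    · linarith [min_le_right (ε / 3) ((r + φ s + (1 - s) * d) / 3)]
  obtain ⟨δ, hδ, hδs, hδs', hδ1, hδ2⟩ : ∃ δ : ℝ, 0 < δ ∧ 0 < s - δ ∧ s + δ < 1 ∧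
      φ (s + δ) ≤ φ s + δ * d + δ * κ / 2 ∧ φ (s - δ) ≤ φ s - δ * d + δ * κ / 2 := by
    have h := (hasDerivAt_iff_isLittleO.1 hd).def (half_pos hκ)
    obtain ⟨δ₀, hδ₀, hball⟩ := Metric.eventually_nhds_iff.1 h
    have hpos : 0 < min (δ₀ / 2) (min (s / 2) ((1 - s) / 2)) :=
      lt_min (by linarith) (lt_min (by linarith [hs.1]) (by linarith [hs.2]))
    have m1 := min_le_left (δ₀ / 2) (min (s / 2) ((1 - s) / 2))
    have m2 := (min_le_right (δ₀ / 2) (min (s / 2) ((1 - s) / 2))).trans (min_le_left _ _)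
    have m3 := (min_le_right (δ₀ / 2) (min (s / 2) ((1 - s) / 2))).trans (min_le_right _ _)
    set δ := min (δ₀ / 2) (min (s / 2) ((1 - s) / 2))
    refine ⟨δ, hpos, by linarith [hs.1], by linarith [hs.2], ?_, ?_⟩
    · have := hball (y := s + δ) (by
        rw [Real.dist_eq, add_sub_cancel_left, abs_of_pos hpos]; linarith)
      simp only [add_sub_cancel_left, smul_eq_mul, Real.norm_eq_abs, abs_of_pos hpos] at this
      linarith [(abs_le.1 this).2]
    · have := hball (y := s - δ) (by
        rw [Real.dist_eq, sub_sub_cancel_left, abs_neg, abs_of_pos hpos]; linarith)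
      simp only [sub_sub_cancel_left, smul_eq_mul, Real.norm_eq_abs, abs_neg,
        abs_of_pos hpos] at this
      linarith [(abs_le.1 this).2]
  have hδ' : δ < 1 := by linarith [hs.2]
  -- With `δ κ / 2 = 4 η`, each tail term has exponent at most `φ s - 4 η + η`, which is `2 η` below
  -- the lower bound `φ s - η` for the main term.
  obtain ⟨η, hη⟩ : ∃ η, η = δ * κ / 8 := ⟨_, rfl⟩
  have hη0 : 0 < η := by rw [hη]; positivity
  have hηκ : η ≤ κ := by rw [hη]; nlinarith
  filter_upwards [eventually_rpow_le_of_tendsto_log2 hη0 (hφ s hs),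
    eventually_rpow_le_of_tendsto_log2 hη0 (hφ (s + δ) ⟨by linarith, hδs'⟩),
    eventually_rpow_le_of_tendsto_log2 hη0 (hφ (s - δ) ⟨hδs, by linarith⟩),
    eventually_two_rpow_neg_mul_le (c := 2 * η) (K := 1 / 4) (by positivity) (by norm_num),
    eventually_two_rpow_neg_mul_le (c := κ) (K := 1 / 8) hκ (by norm_num)]
    with n hz hz1 hz2 hn1 hn2
  refine le_optTypeI fun M hM hMr => ?_
  have h2 : (0 : ℝ) < 2 := two_pos
  have hn0 : (0 : ℝ) ≤ n := n.cast_nonneg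
  have key := tilted_trace_le_errors (hρ n).1 (hσ n).1 (L := (2 : ℝ) ^ (n * d))
    (e := (2 : ℝ) ^ (n * κ)) (by positivity)
    (Real.one_le_rpow one_le_two (by positivity)) hδ hδs hδs' hM
  have mono : ∀ {x y : ℝ}, x ≤ y → (2 : ℝ) ^ (n * x) ≤ (2 : ℝ) ^ (n * y) := fun h =>
    Real.rpow_le_rpow_of_exponent_le one_le_two (mul_le_mul_of_nonneg_left h hn0)
  have eL : ((2 : ℝ) ^ (n * d))⁻¹ = 2 ^ (n * (-d)) := by
    rw [← Real.rpow_neg h2.le]; ring_nf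
  have ee : ((2 : ℝ) ^ (n * κ))⁻¹ = 2 ^ (n * (-κ)) := by
    rw [← Real.rpow_neg h2.le]; ring_nf
  have eLs : ((2 : ℝ) ^ (n * d)) ^ (-s) = 2 ^ (n * (-(s * d))) := by
    rw [← Real.rpow_mul h2.le]; ring_nf
  have eLe : ((2 : ℝ) ^ (n * d) * 2 ^ (n * κ)) ^ (-δ) = 2 ^ (n * (-δ * (d + κ))) := by
    rw [← Real.rpow_add h2, ← Real.rpow_mul h2.le]; ring_nf
  have eLe' : ((2 : ℝ) ^ (n * d) / 2 ^ (n * κ)) ^ δ = 2 ^ (n * (δ * (d - κ))) := by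
    rw [← Real.rpow_sub h2, ← Real.rpow_mul h2.le]; ring_nf
  rw [eL, ee, eLs, eLe, eLe'] at key
  have small : (2 : ℝ) ^ (n * (φ s - 3 * η)) ≤ 2 ^ (n * (φ s - η)) / 4 := by
    have : (2 : ℝ) ^ (n * (φ s - 3 * η)) = 2 ^ (n * (φ s - η)) * 2 ^ (-(n * (2 * η))) := by
      rw [← Real.rpow_add h2]; ring_nf
    rw [this]
    linarith [mul_le_mul_of_nonneg_left hn1 (Real.rpow_nonneg h2.le (n * (φ s - η)))]
  have b1 : (2 : ℝ) ^ (n * (-δ * (d + κ))) *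
      (matPow (ρ n) (1 - (s + δ)) * matPow (σ n) (s + δ)).trace.re ≤ 2 ^ (n * (φ s - 3 * η)) := by
    refine (mul_le_mul_of_nonneg_left hz1.2 (by positivity)).trans ?_
    rw [← Real.rpow_add h2, ← mul_add]
    exact mono (by rw [hη]; linarith)
  have b2 : (2 : ℝ) ^ (n * (δ * (d - κ))) *
      (matPow (ρ n) (1 - (s - δ)) * matPow (σ n) (s - δ)).trace.re ≤ 2 ^ (n * (φ s - 3 * η)) := by
    refine (mul_le_mul_of_nonneg_left hz2.2 (by positivity)).trans ?_
    rw [← Real.rpow_add h2, ← mul_add]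
    exact mono (by rw [hη]; linarith)
  have lower : (2 : ℝ) ^ (n * (φ s - s * d - 2 * κ)) / 4 ≤
      (ρ n * (1 - M)).trace.re + 2 ^ (n * (-d)) * (σ n * M).trace.re := by
    refine le_trans ?_ key
    have hpre : (0 : ℝ) ≤ 2 ^ (n * (-(s * d))) * 2 ^ (n * (-κ)) := by positivity
    have hbr : (2 : ℝ) ^ (n * (φ s - η)) / 2 ≤ (matPow (ρ n) (1 - s) * matPow (σ n) s).trace.re -
        (2 : ℝ) ^ (n * (-δ * (d + κ))) *
          (matPow (ρ n) (1 - (s + δ)) * matPow (σ n) (s + δ)).trace.re -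
        (2 : ℝ) ^ (n * (δ * (d - κ))) *
          (matPow (ρ n) (1 - (s - δ)) * matPow (σ n) (s - δ)).trace.re := by
      linarith [hz.1]
    have := mul_le_mul_of_nonneg_left hbr hpre
    refine le_trans ?_ (div_le_div_of_nonneg_right this h2.le)
    have e : (2 : ℝ) ^ (n * (-(s * d))) * 2 ^ (n * (-κ)) * (2 ^ (n * (φ s - η)) / 2) / 2 =
        2 ^ (n * (φ s - s * d - κ - η)) / 4 := by
      have : (2 : ℝ) ^ (n * (φ s - s * d - κ - η)) =
          2 ^ (n * (-(s * d))) * 2 ^ (n * (-κ)) * 2 ^ (n * (φ s - η)) := by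
        rw [← Real.rpow_add h2, ← Real.rpow_add h2]; ring_nf
      rw [this]; ring
    rw [e]
    exact div_le_div_of_nonneg_right (mono (by linarith)) (by norm_num)
  have hX : (2 : ℝ) ^ (n * (φ s - s * d - 3 * κ)) ≤ 2 ^ (n * (φ s - s * d - 2 * κ)) / 8 := by
    have : (2 : ℝ) ^ (n * (φ s - s * d - 3 * κ)) =
        2 ^ (n * (φ s - s * d - 2 * κ)) * 2 ^ (-(n * κ)) := by
      rw [← Real.rpow_add h2]; ring_nf
    rw [this]
    linarith [mul_le_mul_of_nonneg_left hn2 (Real.rpow_nonneg h2.le (n * (φ s - s * d - 2 * κ)))]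
  -- This is where `g s < r` enters: `-d - r ≤ φ s - s d - 3 κ`.
  have hII : (2 : ℝ) ^ (n * (-d)) * (σ n * M).trace.re ≤ 2 ^ (n * (φ s - s * d - 3 * κ)) := by
    refine (mul_le_mul_of_nonneg_left hMr (by positivity)).trans ?_
    rw [← mul_neg, ← Real.rpow_add h2, ← mul_add]
    exact mono (by linarith)
  have hfin : (2 : ℝ) ^ (n * (φ s - s * d - ε)) ≤ 2 ^ (n * (φ s - s * d - 3 * κ)) :=
    mono (by linarith)
  linarith

/-- The converse bound on the Hoeffding exponent from one supporting line of `φ`. -/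
theorem limsup_optTypeI_le (hρ : ∀ n, IsState (ρ n)) (hσ : ∀ n, IsState (σ n)) {φ : ℝ → ℝ}
    (hφ : ∀ s ∈ Ioo (0 : ℝ) 1, Tendsto (fun n : ℕ => ((1 / (n : ℝ) : ℝ) : EReal) *
      log2 (matPow (ρ n) (1 - s) * matPow (σ n) s).trace.re) atTop (𝓝 ((φ s : ℝ) : EReal)))
    {s d r : ℝ} (hs : s ∈ Ioo (0 : ℝ) 1) (hd : HasDerivAt φ d s)
    (hr : -φ s - (1 - s) * d < r) :
    limsup (fun n : ℕ => -(((1 / (n : ℝ) : ℝ) : EReal) * log2 (optTypeI n r (ρ n) (σ n)))) atTop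
      ≤ ((s * d - φ s : ℝ) : EReal) := by
  by_contra! hlt
  obtain ⟨x, hx, hx'⟩ := EReal.lt_iff_exists_real_btwn.1 hlt
  rw [EReal.coe_lt_coe_iff] at hx
  refine hx'.not_ge (limsup_le_of_le (by isBoundedDefault) ?_)
  filter_upwards [eventually_le_optTypeI hρ hσ hφ hs hd hr (ε := x - (s * d - φ s)) (by linarith),
    eventually_gt_atTop 0] with n hn hn0
  have hn' : (0 : ℝ) < n := by exact_mod_cast hn0
  have hpos : 0 < optTypeI n r (ρ n) (σ n) := lt_of_lt_of_le (by positivity) hn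
  rw [log2_of_pos hpos, ← EReal.coe_mul, ← EReal.coe_neg, EReal.coe_le_coe_iff, one_div,
    ← div_eq_inv_mul, neg_le, le_div_iff₀' hn', Real.le_logb_iff_rpow_le one_lt_two hpos]
  refine le_trans (le_of_eq ?_) hn
  ring_nf

theorem rate_nonpos (hρ : ∀ n, IsState (ρ n)) (hσ : ∀ n, IsState (σ n)) {s c : ℝ}
    (hs : s ∈ Ioo (0 : ℝ) 1)
    (h : Tendsto (fun n : ℕ => ((1 / (n : ℝ) : ℝ) : EReal) *
      log2 (matPow (ρ n) (1 - s) * matPow (σ n) s).trace.re) atTop (𝓝 ((c : ℝ) : EReal))) :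
    c ≤ 0 := by
  by_contra! hc
  obtain ⟨n, hn, hn0⟩ := ((eventually_rpow_le_of_tendsto_log2 (half_pos hc) h).and
    (eventually_gt_atTop 0)).exists
  have hn' : (0 : ℝ) < n := by exact_mod_cast hn0
  have h1 := hn.1.trans (trace_matPow_mul_matPow_le_one (hρ n) (hσ n) hs.1 hs.2)
  exact h1.not_gt (Real.one_lt_rpow one_lt_two (mul_pos hn' (by linarith)))

theorem tendsto_petzRate {α c : ℝ}
    (h : Tendsto (fun n : ℕ => ((1 / (n : ℝ) : ℝ) : EReal) *
      log2 (matPow (ρ n) (1 - (1 - α)) * matPow (σ n) (1 - α)).trace.re) atTop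
        (𝓝 ((c : ℝ) : EReal))) :
    Tendsto (petzRate α ρ σ) atTop (𝓝 ((1 / (α - 1) * c : ℝ) : EReal)) := by
  have h2 := EReal.Tendsto.const_mul (a := ((1 / (α - 1) : ℝ) : EReal)) h
    (Or.inl (EReal.coe_ne_bot _)) (Or.inl (EReal.coe_ne_top _))
  rw [EReal.coe_mul]
  refine h2.congr fun n => ?_
  rw [petzRate, petzD, petzQ, sub_sub_cancel]
  exact mul_left_comm _ _ _

end Converse

/-- A nonpositive convex function on `(0, 1)` lies below its chords from the origin. -/
theorem mul_le_mul_of_convexOn_of_nonpos {φ : ℝ → ℝ} (hconv : ConvexOn ℝ (Ioo (0 : ℝ) 1) φ)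
    (hneg : ∀ s ∈ Ioo (0 : ℝ) 1, φ s ≤ 0) {t s : ℝ} (ht : 0 < t) (hts : t < s) (hs : s < 1) :
    s * φ t ≤ t * φ s := by
  -- Nothing is known at the endpoint 0, so slopes are compared on `u < t < s` and `u → 0⁺`.
  have hlim : Tendsto (fun u : ℝ => (φ s - φ t) * (t - u)) (𝓝[>] 0)
      (𝓝 ((φ s - φ t) * (t - 0))) :=
    (Continuous.tendsto (by fun_prop) 0).mono_left nhdsWithin_le_nhds
  have h : φ t * (s - t) ≤ (φ s - φ t) * (t - 0) := by
    refine ge_of_tendsto hlim ?_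
    filter_upwards [Ioo_mem_nhdsGT ht] with u hu
    have h1 := hconv.slope_mono_adjacent ⟨hu.1, by linarith [hu.2]⟩ ⟨by linarith, hs⟩ hu.2 hts
    rw [div_le_div_iff₀ (by linarith [hu.2]) (by linarith)] at h1
    nlinarith [hneg u ⟨hu.1, by linarith [hu.2]⟩]
  linarith

end QHoeffding

/-! ### Optimization over the tilting parameter. -/

open QHoeffding in
theorem mainTheorem12 {ι : Type*} [Fintype ι] [DecidableEq ι]
    (ρ σ : ∀ n : ℕ, QHoeffding.TensorPowerOp ι n)
    (hρ : ∀ n, QHoeffding.IsState (ρ n)) (hσ : ∀ n, QHoeffding.IsState (σ n))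
    (φ : ℝ → ℝ)
    (hφ : ∀ s ∈ Set.Ioo (0 : ℝ) 1,
      Filter.Tendsto
        (fun n : ℕ => ((1 / (n : ℝ) : ℝ) : EReal) *
          QHoeffding.log2
            (QHoeffding.matPow (ρ n) (1 - s) * QHoeffding.matPow (σ n) s).trace.re)
        Filter.atTop (nhds ((φ s : ℝ) : EReal)))
    (hconv : StrictConvexOn ℝ (Set.Ioo (0 : ℝ) 1) φ)
    (hC1 : ContDiffOn ℝ 1 φ (Set.Ioo (0 : ℝ) 1)) :
    (∀ α ∈ Set.Ioo (0 : ℝ) 1,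
      Filter.Tendsto (QHoeffding.petzRate α ρ σ) Filter.atTop
        (nhds (QHoeffding.petzReg α ρ σ))) ∧
    ∀ r : ℝ, 0 < r →
      (r : EReal) < ⨆ α ∈ Set.Ioo (0 : ℝ) 1, QHoeffding.petzReg α ρ σ →
      (r : EReal) ≠ ⨅ α ∈ Set.Ioo (0 : ℝ) 1, QHoeffding.petzReg α ρ σ →
      Filter.limsup
        (fun n : ℕ => -(((1 / (n : ℝ) : ℝ) : EReal) *
          QHoeffding.log2 (QHoeffding.optTypeI n r (ρ n) (σ n))))
        Filter.atTop
      ≤ ⨆ α ∈ Set.Ioo (0 : ℝ) 1,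
          (((α - 1) / α : ℝ) : EReal) * ((r : EReal) - QHoeffding.petzReg α ρ σ) := by
  have hlim : ∀ α ∈ Ioo (0 : ℝ) 1, Tendsto (petzRate α ρ σ) atTop
      (𝓝 ((1 / (α - 1) * φ (1 - α) : ℝ) : EReal)) := fun α hα =>
    tendsto_petzRate (hφ (1 - α) ⟨by linarith [hα.2], by linarith [hα.1]⟩)
  have hreg : ∀ α ∈ Ioo (0 : ℝ) 1, petzReg α ρ σ = ((1 / (α - 1) * φ (1 - α) : ℝ) : EReal) :=
    fun α hα => (hlim α hα).limsup_eq
  refine ⟨fun α hα => by rw [hreg α hα]; exact hlim α hα, fun r _ _ hrinf => ?_⟩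
  have hneg : ∀ s ∈ Ioo (0 : ℝ) 1, φ s ≤ 0 := fun s hs => rate_nonpos hρ hσ hs (hφ s hs)
  have hdiff : ∀ s ∈ Ioo (0 : ℝ) 1, HasDerivAt φ (deriv φ s) s := fun s hs =>
    ((hC1.differentiableOn one_ne_zero).differentiableAt (isOpen_Ioo.mem_nhds hs)).hasDerivAt
  have hdcont : ContinuousOn (deriv φ) (Ioo 0 1) :=
    hC1.continuousOn_deriv_of_isOpen isOpen_Ioo le_rfl
  have hdmono : StrictMonoOn (deriv φ) (Ioo 0 1) :=
    hconv.strictMonoOn_deriv fun s hs => (hdiff s hs).differentiableAt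
  have hhalf : (1 / 2 : ℝ) ∈ Ioo (0 : ℝ) 1 := by norm_num
  set R := ⨆ α ∈ Set.Ioo (0 : ℝ) 1,
    (((α - 1) / α : ℝ) : EReal) * ((r : EReal) - petzReg α ρ σ)
  set l := limsup (fun n : ℕ => -(((1 / (n : ℝ) : ℝ) : EReal) *
    log2 (optTypeI n r (ρ n) (σ n)))) atTop
  have hRge : ∀ s ∈ Ioo (0 : ℝ) 1, (((-(s * r) - φ s) / (1 - s) : ℝ) : EReal) ≤ R := by
    intro s hs
    have hs' : 1 - s ∈ Ioo (0 : ℝ) 1 := ⟨by linarith [hs.2], by linarith [hs.1]⟩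
    refine le_trans (le_of_eq ?_) (le_iSup₂ (f := fun (α : ℝ) (_ : α ∈ Ioo (0 : ℝ) 1) =>
      (((α - 1) / α : ℝ) : EReal) * ((r : EReal) - petzReg α ρ σ)) (1 - s) hs')
    simp only [hreg _ hs', ← EReal.coe_sub, ← EReal.coe_mul, sub_sub_cancel]
    congr 1
    have h1 : 1 - s ≠ 0 := hs'.1.ne'
    have h2 : s ≠ 0 := hs.1.ne'
    have h3 : 1 - s - 1 = -s := by ring
    rw [h3]
    field_simp
    ring
  have hlle : ∀ s ∈ Ioo (0 : ℝ) 1, -φ s - (1 - s) * deriv φ s < r →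
      l ≤ ((s * deriv φ s - φ s : ℝ) : EReal) := fun s hs hlt =>
    limsup_optTypeI_le hρ hσ hφ hs (hdiff s hs) hlt
  have hgcont : ContinuousOn (fun s => -φ s - (1 - s) * deriv φ s) (Ioo 0 1) := by
    have := hC1.continuousOn
    fun_prop
  by_cases hA : ∃ s ∈ Ioo (0 : ℝ) 1, -φ s - (1 - s) * deriv φ s = r
  · obtain ⟨s₀, hs₀, hg⟩ := hA
    have heq : (-(s₀ * r) - φ s₀) / (1 - s₀) = s₀ * deriv φ s₀ - φ s₀ := by
      have h1 : 1 - s₀ ≠ 0 := by linarith [hs₀.2]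
      rw [← hg]
      field_simp
      ring
    refine le_trans ?_ (heq ▸ hRge s₀ hs₀)
    have hB : ContinuousOn (fun s => s * deriv φ s - φ s) (Ioo 0 1) := by
      have := hC1.continuousOn
      fun_prop
    have ht : Tendsto (fun s => ((s * deriv φ s - φ s : ℝ) : EReal)) (𝓝[>] s₀)
        (𝓝 ((s₀ * deriv φ s₀ - φ s₀ : ℝ) : EReal)) :=
      EReal.tendsto_coe.2
        ((hB.continuousAt (isOpen_Ioo.mem_nhds hs₀)).tendsto.mono_left nhdsWithin_le_nhds)
    -- The bound needs `g s < r` strictly, so it is applied to the right of `s₀`, where `g` is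
    -- smaller, and passed to the limit.
    refine ge_of_tendsto ht ?_
    filter_upwards [Ioo_mem_nhdsGT hs₀.2] with s hs
    have hs' : s ∈ Ioo (0 : ℝ) 1 := ⟨hs₀.1.trans hs.1, hs.2⟩
    refine hlle s hs' ?_
    have h1 := hconv.convexOn.deriv_le_slope hs₀ hs' hs.1 (hdiff s₀ hs₀).differentiableAt
    rw [slope_def_field, le_div_iff₀ (by linarith [hs.1])] at h1
    have h2 := mul_lt_mul_of_pos_left (hdmono hs₀ hs' hs.1) (sub_pos.2 hs.2)
    linarith
  by_contra! hlt
  by_cases hC : ∀ s ∈ Ioo (0 : ℝ) 1, -φ s - (1 - s) * deriv φ s < r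
  · obtain ⟨x, hRx, hxl⟩ := EReal.lt_iff_exists_real_btwn.1 hlt
    obtain ⟨y, hxy, hyl⟩ := EReal.lt_iff_exists_real_btwn.1 hxl
    rw [EReal.coe_lt_coe_iff] at hxy
    -- For `s < 1 / 2`, using `φ'(s) < φ'(1 / 2)` and `φ s ≤ 0`, the bound from `hlle` exceeds the
    -- objective at `s` by less than `s` times this constant.
    have hK : 0 < |deriv φ (1 / 2)| + 2 * |r| + 1 := by positivity
    obtain ⟨s, hs0, hs2, hsK⟩ : ∃ s : ℝ, 0 < s ∧ s < 1 / 2 ∧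
        s * (|deriv φ (1 / 2)| + 2 * |r| + 1) ≤ y - x := by
      refine ⟨min (1 / 4) ((y - x) / (|deriv φ (1 / 2)| + 2 * |r| + 1)),
        lt_min (by norm_num) (div_pos (by linarith) hK),
        (min_le_left _ _).trans_lt (by norm_num), ?_⟩
      rw [← le_div_iff₀ hK]
      exact min_le_right _ _
    have hs : s ∈ Ioo (0 : ℝ) 1 := ⟨hs0, by linarith⟩
    have h1 : y < s * deriv φ s - φ s :=
      EReal.coe_lt_coe_iff.1 (hyl.trans_le (hlle s hs (hC s hs)))
    have h2 := EReal.coe_lt_coe_iff.1 ((hRge s hs).trans_lt hRx)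
    have h3 := hdmono hs hhalf hs2
    have h4 := hneg s hs
    rw [div_lt_iff₀ (by linarith)] at h2
    have h5 := le_abs_self (deriv φ (1 / 2))
    have h6 := le_abs_self r
    have h7 : (y - x) * (1 - s) < s * (1 - s) * deriv φ s + s * r + s * φ s := by
      nlinarith
    have h8 : s * (1 - s) * deriv φ s ≤ s * (1 - s) * |deriv φ (1 / 2)| :=
      mul_le_mul_of_nonneg_left (by linarith) (mul_nonneg hs0.le (by linarith))
    have h9 : s * r ≤ s * (1 - s) * (2 * |r|) := by
      nlinarith [mul_nonneg (mul_nonneg hs0.le (abs_nonneg r)) (by linarith : 0 ≤ 1 - 2 * s)]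
    have h10 : s * φ s ≤ 0 := mul_nonpos_of_nonneg_of_nonpos hs0.le h4
    have h11 := mul_le_mul_of_nonneg_right hsK (by linarith : 0 ≤ 1 - s)
    nlinarith [mul_pos hs0 (by linarith : 0 < 1 - s)]
  -- Since `g` is continuous and never equals `r`, it stays above `r`.
  · have hB : ∀ s ∈ Ioo (0 : ℝ) 1, r < -φ s - (1 - s) * deriv φ s := by
      push Not at hC
      obtain ⟨s₁, hs₁, hg₁⟩ := hC
      intro s hs
      by_contra! hg
      obtain ⟨s', hs', he⟩ := isPreconnected_Ioo.intermediate_value hs hs₁ hgcont ⟨hg, hg₁⟩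
      exact hA ⟨s', hs', he⟩
    obtain ⟨C, hC, -⟩ := EReal.lt_iff_exists_real_btwn.1 hlt
    have hCle : ∀ s ∈ Ioo (0 : ℝ) 1, -(s * r) - φ s < C * (1 - s) := fun s hs => by
      have h := EReal.coe_lt_coe_iff.1 ((hRge s hs).trans_lt hC)
      rwa [div_lt_iff₀ (by linarith [hs.2])] at h
    refine hrinf (le_antisymm (le_iInf₂ fun α hα => ?_) ?_)
    -- `r ≤ D_α`: as `s → 1`, `g s > r` and `φ'(s) > φ'(1 / 2)` bound `φ s` by a quantity tending to
    -- `-r`; the chord inequality `s φ t ≤ t φ s` then gives `φ t ≤ -t r`.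
    · obtain ⟨t, ht, rfl⟩ : ∃ t ∈ Ioo (0 : ℝ) 1, α = 1 - t :=
        ⟨1 - α, ⟨by linarith [hα.2], by linarith [hα.1]⟩, by ring⟩
      rw [hreg _ hα, EReal.coe_le_coe_iff, sub_sub_cancel, sub_sub_cancel_left, one_div, inv_neg,
        neg_mul, ← div_eq_inv_mul, le_neg, div_le_iff₀ ht.1]
      have hl1 : Tendsto (fun s : ℝ => t * -(r + (1 - s) * deriv φ (1 / 2)) - s * φ t) (𝓝[<] 1)
          (𝓝 (t * -(r + (1 - 1) * deriv φ (1 / 2)) - 1 * φ t)) :=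
        (Continuous.tendsto (by fun_prop) 1).mono_left nhdsWithin_le_nhds
      have := ge_of_tendsto (b := 0) hl1 (by
        filter_upwards [Ioo_mem_nhdsLT ht.2, Ioo_mem_nhdsLT hhalf.2] with s hs hs2
        have hs' : s ∈ Ioo (0 : ℝ) 1 := ⟨ht.1.trans hs.1, hs.2⟩
        have h1 := mul_le_mul_of_convexOn_of_nonpos hconv.convexOn hneg ht.1 hs.1 hs.2
        have h2 := hB s hs'
        have h3 := mul_lt_mul_of_pos_left (hdmono hhalf hs' hs2.1) (sub_pos.2 hs.2)
        have h4 := mul_le_mul_of_nonneg_left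
          (show φ s ≤ -(r + (1 - s) * deriv φ (1 / 2)) by linarith) ht.1.le
        linarith)
      linarith
    -- Finiteness of the supremum gives `D_{1-s} < r + C (1 - s) / s`, which tends to `r` as `s →
    -- 1`.
    · by_contra! hri
      obtain ⟨x, hrx, hx⟩ := EReal.lt_iff_exists_real_btwn.1 hri
      rw [EReal.coe_lt_coe_iff] at hrx
      have hl1 : Tendsto (fun s : ℝ => s * r + C * (1 - s) - s * x) (𝓝[<] 1)
          (𝓝 (1 * r + C * (1 - 1) - 1 * x)) :=
        (Continuous.tendsto (by fun_prop) 1).mono_left nhdsWithin_le_nhds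
      have := ge_of_tendsto (b := 0) hl1 (by
        filter_upwards [Ioo_mem_nhdsLT zero_lt_one] with s hs
        have hs' : 1 - s ∈ Ioo (0 : ℝ) 1 := ⟨by linarith [hs.2], by linarith [hs.1]⟩
        have h1 := hx.trans_le (iInf₂_le (1 - s) hs')
        rw [hreg _ hs', EReal.coe_lt_coe_iff, sub_sub_cancel, sub_sub_cancel_left, one_div,
          inv_neg, neg_mul, ← div_eq_inv_mul, lt_neg, div_lt_iff₀ hs.1] at h1
        linarith [hCle s hs])
      linarith
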